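/- A \emph{tree} over a finite alphabet $\Sigma$ is a map $t\colon D\to\Sigma$ where $D=\operatorname{dom}(t)\subseteq\{0,1\}^\star$ is finite and prefix-closed (possibly empty). A \emph{(deterministic bottom-up) tree automaton} over $\Sigma$ consists of a finite set $Q$ of states, a start state $\iota\in Q$, a transition function $\delta\colon\Sigma\times Q\times Q\to Q$ and a set $F\subseteq Q$ of accepting states. It assigns the state $\iota$ to the empty tree and the state $\delta(a,q_0,q_1)$ to a tree with root label $a$ whose left and right subtrees are assigned $q_0$ and $q_1$; it recognises the set of all trees over $\Sigma$ that are assigned a state in $F$. The \emph{convolution} $s\otimes t$ of two trees over $\Sigma$ is the tree over $(\Sigma\cup\{\Box\})^2$, with $\Box\notin\Sigma$, whose domain is $\operatorname{dom}(s)\cup\operatorname{dom}(t)$ and whose label at $u$ is the pair of the labels of $s$ and $t$ at $u$, where $\Box$ stands for a missing label. A linear ordering $(A;\le)$ is \emph{tree-automatic} if there are a finite alphabet $\Sigma$ and an injective map $\mu$ from $A$ to the trees over $\Sigma$ such that both $\mu(A)$ and $\{\mu(x)\otimes\mu(y) : x,y\in A,\ x\le y\}$ are recognised by tree automata. For a linear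 ordering $A$ define equivalence relations $\sim_\alpha$ on $A$, all of whose classes are intervals, by transfinite recursion on the ordinal $\alpha$: $\sim_0$ is equality; $x\sim_{\beta+1}y$ iff the closed interval between the $\sim_\beta$-classes of $x$ and $y$ in the quotient ordering $A/{\sim_\beta}$ is finite; and for limit $\alpha$, $x\sim_\alpha y$ iff $x\sim_\beta y$ for some $\beta<\alpha$. The \emph{$\operatorname{FC}$-rank} $\operatorname{FC}(A)$ is the least ordinal $\alpha$ such that $\sim_\beta$ coincides with $\sim_\alpha$ for every $\beta\ge\alpha$. \textbf{Theorem.} Every tree-automatic linear ordering $A$ satisfies $\operatorname{FC}(A)<\omega^\omega$. -/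

import Mathlib

universe u

/-! ### Finite labelled binary trees

A tree over an alphabet `S` is a map `D → S` on a finite prefix-closed set `D ⊆ {0,1}*`.  Such maps
are the elements of the inductive type `BinaryTree S` (`nil` being the empty tree): see
`treeLabel_finite`, `treeLabel_prefix` and `existsUnique_treeLabel_eq` below. -/

/-- The label of a tree at an address (`false` is left, `true` is right), or `none` if the address
is not in the domain of the tree. -/
def treeLabel {S : Type u} : BinaryTree S → List Bool → Option S
  | .nil, _ => none
  | .node a _ _, [] => some a
  | .node _ l _, false :: w => treeLabel l w
  | .node _ _ r, true :: w => treeLabel r w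

theorem treeLabel_finite {S : Type u} (t : BinaryTree S) : {w | treeLabel t w ≠ none}.Finite := by
  induction t with
  | nil => simp [treeLabel]
  | node a l r hl hr =>
    refine ((Set.finite_singleton []).union
      ((hl.image (List.cons false)).union (hr.image (List.cons true)))).subset ?_
    rintro (_ | ⟨_ | _, w⟩) hw
    · simp
    · right; left; exact ⟨w, hw, rfl⟩
    · right; right; exact ⟨w, hw, rfl⟩

theorem treeLabel_prefix {S : Type u} (t : BinaryTree S) (v w : List Bool) (hvw : v <+: w)
    (hw : treeLabel t w ≠ none) : treeLabel t v ≠ none := by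
  induction t generalizing v w with
  | nil => simp [treeLabel] at hw
  | node a l r hl hr =>
    obtain ⟨s, rfl⟩ := hvw
    rcases v with _ | ⟨_ | _, v⟩
    · simp [treeLabel]
    · exact hl v (v ++ s) ⟨s, rfl⟩ hw
    · exact hr v (v ++ s) ⟨s, rfl⟩ hw

theorem treeLabel_injective {S : Type u} :
    Function.Injective (treeLabel : BinaryTree S → List Bool → Option S) := by
  intro s
  induction s with
  | nil =>
    rintro (_ | ⟨b, l', r'⟩) h
    · rfl
    · simpa [treeLabel] using congrFun h []
  | node a l r hl hr =>
    rintro (_ | ⟨b, l', r'⟩) h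
    · simpa [treeLabel] using congrFun h []
    · have h0 : a = b := by simpa [treeLabel] using congrFun h []
      have h1 : l = l' := hl (funext fun w => congrFun h (false :: w))
      have h2 : r = r' := hr (funext fun w => congrFun h (true :: w))
      rw [h0, h1, h2]

/-- Every labelling of a finite prefix-closed set of addresses is given by exactly one tree. -/
theorem existsUnique_treeLabel_eq {S : Type u} (f : List Bool → Option S)
    (hfin : {w | f w ≠ none}.Finite) (hpre : ∀ v w, v <+: w → f w ≠ none → f v ≠ none) :
    ∃! t : BinaryTree S, treeLabel t = f := by
  refine existsUnique_of_exists_of_unique ?_ fun s t hs ht => treeLabel_injective (hs.trans ht.symm)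
  obtain ⟨n, hn⟩ : ∃ n : ℕ, ∀ w, f w ≠ none → w.length < n := by
    obtain ⟨n, hn⟩ := (hfin.image List.length).bddAbove
    exact ⟨n + 1, fun w hw => Nat.lt_succ_of_le (hn ⟨w, hw, rfl⟩)⟩
  clear hfin
  induction n generalizing f with
  | zero =>
    refine ⟨.nil, funext fun w => ?_⟩
    by_contra h
    exact absurd (hn w fun h' => h (by rw [h']; rfl)) (Nat.not_lt_zero _)
  | succ n ih =>
    cases h0 : f [] with
    | none =>
      refine ⟨.nil, funext fun w => ?_⟩
      by_contra h
      exact hpre [] w List.nil_prefix (fun h' => h (by rw [h']; rfl)) h0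
    | some a =>
      have key : ∀ b : Bool, ∃ t : BinaryTree S, treeLabel t = fun w => f (b :: w) := fun b =>
        ih (fun w => f (b :: w))
          (fun v w hvw hw => hpre (b :: v) (b :: w) ((List.prefix_cons_inj b).2 hvw) hw)
          (fun w hw => by simpa using hn (b :: w) hw)
      obtain ⟨l, hl⟩ := key false
      obtain ⟨r, hr⟩ := key true
      refine ⟨.node a l r, funext fun w => ?_⟩
      rcases w with _ | ⟨_ | _, w⟩
      · exact h0.symm
      · exact congrFun hl w
      · exact congrFun hr w

/-- The convolution of two trees: its domain is the union of the two domains, and its label at an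
address is the pair of the two labels, where `none` plays the role of the padding symbol. -/
def treeConv {S : Type u} : BinaryTree S → BinaryTree S → BinaryTree (Option S × Option S)
  | .nil, t => t.map fun b => (none, some b)
  | .node a l r, .nil => (BinaryTree.node a l r).map fun c => (some c, none)
  | .node a l r, .node b l' r' => .node (some a, some b) (treeConv l l') (treeConv r r')

theorem treeLabel_map {S T : Type u} (g : S → T) (t : BinaryTree S) (w : List Bool) :
    treeLabel (t.map g) w = (treeLabel t w).map g := by
  induction t generalizing w with
  | nil => simp [treeLabel, BinaryTree.map]
  | node a l r hl hr => rcases w with _ | ⟨_ | _, w⟩ <;> simp [treeLabel, BinaryTree.map, hl, hr]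

theorem treeLabel_treeConv {S : Type u} (s t : BinaryTree S) (w : List Bool) :
    treeLabel (treeConv s t) w =
      match treeLabel s w, treeLabel t w with
      | none, none => none
      | p, q => some (p, q) := by
  induction s generalizing t w with
  | nil =>
    rw [treeConv, treeLabel_map]
    cases h : treeLabel t w <;> simp [treeLabel]
  | node a l r hl hr =>
    cases t with
    | nil =>
      rw [treeConv, treeLabel_map]
      cases h : treeLabel (.node a l r) w <;> simp [treeLabel]
    | node b l' r' =>
      rcases w with _ | ⟨_ | _, w⟩
      · simp [treeLabel, treeConv]
      · exact hl l' w
      · exact hr r' w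

/-! ### Tree automata and tree-automatic linear orderings -/

/-- A deterministic bottom-up tree automaton over the alphabet `S` with state set `Q`. -/
structure TreeAutomaton (S Q : Type) where
  /-- the start state -/
  start : Q
  /-- the transition function -/
  step : S → Q → Q → Q
  /-- the accepting states -/
  accept : Set Q

namespace TreeAutomaton

/-- The state in which the automaton is at the root of a tree. -/
def eval {S Q : Type} (M : TreeAutomaton S Q) : BinaryTree S → Q
  | .nil => M.start
  | .node a l r => M.step a (M.eval l) (M.eval r)

/-- The tree language recognised by the automaton. -/
def language {S Q : Type} (M : TreeAutomaton S Q) : Set (BinaryTree S) :=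
  {t | M.eval t ∈ M.accept}

end TreeAutomaton

/-- The automata `M`, `N` form a tree-automatic presentation of the ordering `(A; ≤)` with naming
function `μ`: it is a bijection from `A` onto the language of `M`, and `N` recognises the set of
convolutions of the pairs in the image of the order relation. -/
structure IsTreeAutomaticPresentation {A : Type u} [LE A] {S Q Q' : Type}
    (M : TreeAutomaton S Q) (N : TreeAutomaton (Option S × Option S) Q')
    (μ : A → BinaryTree S) : Prop where
  bijOn : Set.BijOn μ Set.univ M.language
  recognises : N.language = {t | ∃ x y : A, x ≤ y ∧ t = treeConv (μ x) (μ y)}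

/-- `(A; ≤)` has a presentation by tree automata with finite alphabet and finite state sets. -/
def IsTreeAutomatic (A : Type u) [LE A] : Prop :=
  ∃ (S Q Q' : Type) (_ : Finite S) (_ : Finite Q) (_ : Finite Q')
    (M : TreeAutomaton S Q) (N : TreeAutomaton (Option S × Option S) Q') (μ : A → BinaryTree S),
    IsTreeAutomaticPresentation M N μ

/-! ### Condensations and the FC-rank -/

section FCRank

variable {A : Type u} [LinearOrder A]

/-- The class of `x` under the relation `r`. -/
def relClass (r : A → A → Prop) (x : A) : Set A := {y | r x y}

/-- A condensation: an equivalence relation all of whose classes are intervals. -/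
def IsCondensation (r : A → A → Prop) : Prop :=
  Equivalence r ∧ ∀ x, (relClass r x).OrdConnected

/-- Every element of `X` lies strictly below every element of `Y`. -/
def SetBelow (X Y : Set A) : Prop := ∀ x ∈ X, ∀ y ∈ Y, x < y

/-- The non-strict order on the classes of a condensation. -/
def ClassLE (X Y : Set A) : Prop := X = Y ∨ SetBelow X Y

/-- The closed interval with end points `X`, `Y` (in either order) in the quotient ordering, whose
elements are the classes of `r`. -/
def classInterval (r : A → A → Prop) (X Y : Set A) : Set (Set A) :=
  {Z | Z ∈ Set.range (relClass r) ∧ ((ClassLE X Z ∧ ClassLE Z Y) ∨ (ClassLE Y Z ∧ ClassLE Z X))}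

/-- `x` and `y` are related if their `r`-classes are finitely far apart in the quotient by `r`. -/
def fcStep (r : A → A → Prop) (x y : A) : Prop :=
  (classInterval r (relClass r x) (relClass r y)).Finite

/-- The iterated finite condensation relations `∼_α`. -/
noncomputable def fcRel (α : Ordinal.{u}) : A → A → Prop :=
  Ordinal.limitRecOn (motive := fun _ => A → A → Prop) α
    (fun x y => x = y)
    (fun _ r => fcStep r)
    (fun α _ r x y => ∃ (β : Ordinal.{u}) (h : β < α), r β h x y)

theorem fcRel_zero (x y : A) : fcRel 0 x y ↔ x = y := by
  simp [fcRel]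

theorem fcRel_add_one (α : Ordinal.{u}) : (fcRel (α + 1) : A → A → Prop) = fcStep (fcRel α) := by
  simp [fcRel]

theorem fcRel_limit (α : Ordinal.{u}) (hα : Order.IsSuccLimit α) (x y : A) :
    fcRel α x y ↔ ∃ β < α, fcRel β x y := by
  simp [fcRel, Ordinal.limitRecOn_limit _ _ _ _ hα]

theorem IsCondensation.relClass_eq {r : A → A → Prop} (hr : IsCondensation r) {x y : A} :
    relClass r x = relClass r y ↔ r x y := by
  constructor
  · intro h
    have : y ∈ relClass r x := by rw [h]; exact hr.1.refl y
    exact this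
  · intro h
    ext z
    exact ⟨fun hz => hr.1.trans (hr.1.symm h) hz, fun hz => hr.1.trans h hz⟩

theorem IsCondensation.classLE_iff {r : A → A → Prop} (hr : IsCondensation r) {x y : A} :
    ClassLE (relClass r x) (relClass r y) ↔ x ≤ y ∨ r x y := by
  rw [ClassLE, hr.relClass_eq]
  constructor
  · rintro (h | h)
    · exact Or.inr h
    · exact Or.inl (h x (hr.1.refl x) y (hr.1.refl y)).le
  · rintro (h | h)
    · by_cases hxy : r x y
      · exact Or.inl hxy
      · refine Or.inr fun a ha b hb => ?_
        by_contra hab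
        push Not at hab
        apply hxy
        rcases le_total y a with hya | hya
        · exact (hr.2 x).out (hr.1.refl x) ha ⟨h, hya⟩
        · have : a ∈ relClass r y := (hr.2 y).out hb (hr.1.refl y) ⟨hab, hya⟩
          exact hr.1.trans ha (hr.1.symm this)
    · exact Or.inl h

theorem IsCondensation.classInterval_eq {r : A → A → Prop} (hr : IsCondensation r) (x y : A) :
    classInterval r (relClass r x) (relClass r y) = relClass r '' Set.uIcc x y := by
  ext Z
  constructor
  · rintro ⟨⟨z, rfl⟩, h⟩
    simp only [hr.classLE_iff] at h
    by_cases hx : r x z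
    · exact ⟨x, Set.left_mem_uIcc, hr.relClass_eq.2 hx⟩
    by_cases hy : r y z
    · exact ⟨y, Set.right_mem_uIcc, hr.relClass_eq.2 hy⟩
    have hx' : ¬ r z x := fun h => hx (hr.1.symm h)
    have hy' : ¬ r z y := fun h => hy (hr.1.symm h)
    simp only [hx, hy, hx', hy', or_false] at h
    exact ⟨z, Set.mem_uIcc.2 h, rfl⟩
  · rintro ⟨z, hz, rfl⟩
    refine ⟨⟨z, rfl⟩, ?_⟩
    simp only [hr.classLE_iff]
    exact (Set.mem_uIcc.1 hz).imp (fun h => ⟨.inl h.1, .inl h.2⟩) (fun h => ⟨.inl h.1, .inl h.2⟩)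

theorem IsCondensation.fcStep_iff {r : A → A → Prop} (hr : IsCondensation r) (x y : A) :
    fcStep r x y ↔ (relClass r '' Set.uIcc x y).Finite := by
  rw [fcStep, hr.classInterval_eq]

theorem IsCondensation.le_fcStep {r : A → A → Prop} (hr : IsCondensation r) {x y : A}
    (h : r x y) : fcStep r x y := by
  rw [hr.fcStep_iff]
  refine (Set.finite_singleton (relClass r x)).subset ?_
  rintro _ ⟨z, hz, rfl⟩
  exact (hr.relClass_eq.2 ((hr.2 x).uIcc_subset (hr.1.refl x) h hz)).symm

theorem IsCondensation.isCondensation_fcStep {r : A → A → Prop} (hr : IsCondensation r) :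
    IsCondensation (fcStep r) := by
  refine ⟨⟨fun x => hr.le_fcStep (hr.1.refl x), fun {x y} h => ?_, fun {x y z} h h' => ?_⟩,
    fun x => ⟨fun y hy w hw z hz => ?_⟩⟩
  · rw [hr.fcStep_iff] at h ⊢
    rwa [Set.uIcc_comm]
  · rw [hr.fcStep_iff] at h h' ⊢
    refine (h.union h').subset ?_
    rw [← Set.image_union]
    exact Set.image_mono Set.uIcc_subset_uIcc_union_uIcc
  · simp only [relClass, Set.mem_ofPred_eq, hr.fcStep_iff] at hy hw ⊢
    refine (hy.union hw).subset ?_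
    rw [← Set.image_union]
    refine Set.image_mono fun v hv => ?_
    rcases Set.mem_uIcc.1 hv with h | h
    · exact Or.inr (Set.mem_uIcc.2 (Or.inl ⟨h.1, h.2.trans hz.2⟩))
    · exact Or.inl (Set.mem_uIcc.2 (Or.inr ⟨hz.1.trans h.1, h.2⟩))

theorem fcRel_aux (α : Ordinal.{u}) : IsCondensation (fcRel α : A → A → Prop) ∧
    ∀ β ≤ α, ∀ x y : A, fcRel β x y → fcRel α x y := by
  induction α using Ordinal.limitRecOn with
  | zero =>
    have h0 : (fcRel 0 : A → A → Prop) = Eq := by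
      funext x y
      exact propext (fcRel_zero x y)
    refine ⟨?_, fun β hβ x y h => ?_⟩
    · rw [h0]
      refine ⟨⟨fun _ => rfl, Eq.symm, Eq.trans⟩, fun x => ⟨fun y hy w hw z hz => ?_⟩⟩
      have hy' : x = y := hy
      have hw' : x = w := hw
      exact le_antisymm (hy' ▸ hz.1) (hw' ▸ hz.2)
    · rwa [nonpos_iff_eq_zero.1 hβ] at h
  | add_one α ih =>
    rw [fcRel_add_one]
    refine ⟨ih.1.isCondensation_fcStep, fun β hβ x y h => ?_⟩
    rcases hβ.lt_or_eq with hlt | rfl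
    · exact ih.1.le_fcStep (ih.2 β (Order.lt_add_one_iff.1 hlt) x y h)
    · rwa [fcRel_add_one] at h
  | limit α hα ih =>
    have up : ∀ β < α, ∀ x y : A, fcRel β x y → fcRel α x y :=
      fun β hβ x y h => (fcRel_limit α hα x y).2 ⟨β, hβ, h⟩
    have two : ∀ {x y z w : A}, fcRel α x y → fcRel α z w →
        ∃ β < α, fcRel β x y ∧ fcRel β z w := by
      intro x y z w h h'
      obtain ⟨β, hβ, h⟩ := (fcRel_limit α hα x y).1 h
      obtain ⟨γ, hγ, h'⟩ := (fcRel_limit α hα z w).1 h'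
      rcases le_total β γ with hle | hle
      · exact ⟨γ, hγ, (ih γ hγ).2 β hle x y h, h'⟩
      · exact ⟨β, hβ, h, (ih β hβ).2 γ hle z w h'⟩
    refine ⟨⟨⟨fun x => ?_, fun {x y} h => ?_, fun {x y z} h h' => ?_⟩,
      fun x => ⟨fun y hy w hw z hz => ?_⟩⟩, fun β hβ x y h => ?_⟩
    · exact up 0 hα.bot_lt x x ((fcRel_zero x x).2 rfl)
    · obtain ⟨β, hβ, h, -⟩ := two h h
      exact up β hβ y x ((ih β hβ).1.1.symm h)
    · obtain ⟨β, hβ, h, h'⟩ := two h h'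
      exact up β hβ x z ((ih β hβ).1.1.trans h h')
    · obtain ⟨β, hβ, h, h'⟩ := two hy hw
      exact up β hβ x z (((ih β hβ).1.2 x).out h h' hz)
    · rcases hβ.lt_or_eq with hlt | rfl
      · exact up β hlt x y h
      · exact h

/-- Each `∼_α` is a condensation. -/
theorem fcRel_isCondensation (α : Ordinal.{u}) : IsCondensation (fcRel α : A → A → Prop) :=
  (fcRel_aux α).1

/-- The relations `∼_α` increase with `α`. -/
theorem fcRel_mono {α β : Ordinal.{u}} (h : α ≤ β) {x y : A} (hxy : fcRel α x y) : fcRel β x y :=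
  (fcRel_aux β).2 α h x y hxy

end FCRank

/-- The FC-rank: the least ordinal from which on the relations `∼_α` no longer change. -/
noncomputable def fcRank (A : Type u) [LinearOrder A] : Ordinal.{u} :=
  sInf {α : Ordinal.{u} | ∀ β : Ordinal.{u}, α ≤ β → (fcRel β : A → A → Prop) = fcRel α}

/-- The relations `∼_α` become stationary, so that the FC-rank is a genuine minimum. -/
theorem fcRank_spec (A : Type u) [LinearOrder A] :
    ∀ β : Ordinal.{u}, fcRank A ≤ β → (fcRel β : A → A → Prop) = fcRel (fcRank A) := by
  suffices h : {α : Ordinal.{u} | ∀ β : Ordinal.{u}, α ≤ β →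
      (fcRel β : A → A → Prop) = fcRel α}.Nonempty from csInf_mem h
  obtain ⟨α, hα⟩ : ∃ α : Ordinal.{u}, (fcRel (α + 1) : A → A → Prop) = fcRel α := by
    have hn := not_injective_of_ordinal (fun α : Ordinal.{u} => (fcRel α : A → A → Prop))
    simp only [Function.Injective, not_forall] at hn
    obtain ⟨α, β, h, hne⟩ := hn
    wlog hlt : α < β generalizing α β
    · exact this β α h.symm (Ne.symm hne) (lt_of_le_of_ne (not_lt.1 hlt) (Ne.symm hne))
    refine ⟨α, funext fun x => funext fun y => propext ⟨fun hxy => ?_, fcRel_mono le_self_add⟩⟩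
    rw [h]
    exact fcRel_mono (Order.add_one_le_of_lt hlt) hxy
  refine ⟨α, fun β => ?_⟩
  induction β using Ordinal.limitRecOn with
  | zero =>
    intro h
    rw [nonpos_iff_eq_zero.1 h]
  | add_one β ih =>
    intro h
    rcases h.lt_or_eq with hlt | rfl
    · rw [fcRel_add_one, ih (Order.lt_add_one_iff.1 hlt), ← fcRel_add_one, hα]
    · rfl
  | limit β hβ ih =>
    intro h
    funext x y
    refine propext ⟨fun hxy => ?_, fcRel_mono h⟩
    obtain ⟨γ, hγ, hxy⟩ := (fcRel_limit β hβ x y).1 hxy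
    rcases le_total α γ with hle | hle
    · rwa [ih γ hγ hle] at hxy
    · exact fcRel_mono hle hxy

/-!
The proof compares the condensation rank with a rank on sets that behaves well under unions and
products, and lets the automata cut an interval into products of finitely many kinds of factors.

A set has rank at most `α` (`RankLE`) if it is a finite union of sets all of whose initial
segments, or all of whose final segments, have rank less than `α`, starting from sets with at most
one point. Up to an error of one this is the least `α` for which the end points of an interval are
`∼_α`-related (`rankLE_Icc`, `rankGE_Icc`); the lower bound goes through a dual rank `RankGE`,
defined like the Morley rank, for which a union has the maximum of the two ranks by the pigeonhole
principle. So if the FC-rank were at least `ω ^ ω`, then for every `n` some closed interval would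
have rank `ω ^ n` or `ω ^ n + 1` (`exists_Icc_rank`).

Fix trees `x` and `y`. The trees `z` with a given `profile`, that is, a given triple of states on
`x ⊗ z`, `z ⊗ y` and `z ⊗ z`, are, apart from the empty tree, finitely many kinds of trees `node a
l r`, where `l` and `r` range independently over profile classes for the children of `x` and `y`.
The state on `z ⊗ z` being fixed, comparing `node a l r` with `node a l' r` does not depend on
`r`, so such a product carries a total preorder that extends a product of two preorders, each
again defined by the given automaton with some set of accepting states. Once `x` and `y` are
exhausted, only finitely many pairs of a profile class and a set of accepting states remain. Hence
for some `n` none of them has rank `ω ^ n` or `ω ^ n + 1` (`exists_gap`), and by induction on the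
height of `x` and `y` no interval has such a rank either (`exists_rankLE_profileClass`), a
contradiction.

The induction needs that products of sets of rank less than `ω ^ n` have rank less than `ω ^ n`.
In fact ranks add up at most to their natural sum (`IsTameProduct.rankLE_natAdd`). This fails for
linear extensions of products in general; it holds here because the order of two pairs depends
only on the states of the automaton on the two pairs of coordinates, a colouring by finitely many
colours (`IsTameProduct.low_high`).
-/

open Ordinal

/-! ### Ranks of sets in a relation -/

/-- `RankLE r α X` says that the set `X`, preordered by `r`, is scattered of rank at most `α`, in
the variant of the Hausdorff rank that is closed under finite unions: a set has rank at most `α`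
if it is a finite union of sets that have at most one point, or all of whose initial segments `{y
| r y x}` have rank less than `α`, or all of whose final segments do. -/
inductive RankLE {T : Type*} (r : T → T → Prop) : Ordinal.{u} → Set T → Prop
  | subsingleton {α : Ordinal.{u}} {X : Set T} : X.Subsingleton → RankLE r α X
  | low {α : Ordinal.{u}} {X : Set T} (f : T → Ordinal.{u}) (hf : ∀ x ∈ X, f x < α)
      (h : ∀ x ∈ X, RankLE r (f x) {y | y ∈ X ∧ r y x}) : RankLE r α X
  | high {α : Ordinal.{u}} {X : Set T} (f : T → Ordinal.{u}) (hf : ∀ x ∈ X, f x < α)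
      (h : ∀ x ∈ X, RankLE r (f x) {y | y ∈ X ∧ r x y}) : RankLE r α X
  | union {α : Ordinal.{u}} {X Y : Set T} : RankLE r α X → RankLE r α Y → RankLE r α (X ∪ Y)

namespace RankLE

variable {T T' : Type*}

/-- The rank does not increase along injective order-preserving maps, nor when passing to a
subset. -/
theorem comap {r : T → T → Prop} {r' : T' → T' → Prop} {φ : T → T'} {α β : Ordinal.{u}}
    {X : Set T} {Y : Set T'} (hY : RankLE r' α Y) (hαβ : α ≤ β) (hm : Set.MapsTo φ X Y)
    (hi : Set.InjOn φ X) (hr : ∀ x ∈ X, ∀ y ∈ X, r x y → r' (φ x) (φ y)) : RankLE r β X := by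
  induction hY generalizing X β with
  | subsingleton h => exact .subsingleton fun x hx y hy => hi hx hy (h (hm hx) (hm hy))
  | low f hf h ih =>
    exact .low (f ∘ φ) (fun x hx => (hf _ (hm hx)).trans_le hαβ) fun x hx =>
      ih (φ x) (hm hx) le_rfl (fun y hy => ⟨hm hy.1, hr _ hy.1 _ hx hy.2⟩)
        (hi.mono fun y hy => hy.1) fun y hy z hz => hr y hy.1 z hz.1
  | high f hf h ih =>
    exact .high (f ∘ φ) (fun x hx => (hf _ (hm hx)).trans_le hαβ) fun x hx =>
      ih (φ x) (hm hx) le_rfl (fun y hy => ⟨hm hy.1, hr _ hx _ hy.1 hy.2⟩)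
        (hi.mono fun y hy => hy.1) fun y hy z hz => hr y hy.1 z hz.1
  | @union _ Y₁ Y₂ _ _ ih₁ ih₂ =>
    have hX : X = {x | x ∈ X ∧ φ x ∈ Y₁} ∪ {x | x ∈ X ∧ φ x ∈ Y₂} := by
      ext x
      exact ⟨fun hx => (hm hx).imp (⟨hx, ·⟩) (⟨hx, ·⟩), fun hx => hx.elim And.left And.left⟩
    rw [hX]
    exact .union
      (ih₁ hαβ (fun x hx => hx.2) (hi.mono fun x hx => hx.1) fun x hx y hy => hr x hx.1 y hy.1)
      (ih₂ hαβ (fun x hx => hx.2) (hi.mono fun x hx => hx.1) fun x hx y hy => hr x hx.1 y hy.1)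

theorem mono {r : T → T → Prop} {α β : Ordinal.{u}} {X Y : Set T} (hY : RankLE r α Y)
    (hαβ : α ≤ β) (hXY : X ⊆ Y) : RankLE r β X :=
  hY.comap (φ := id) hαβ hXY Function.injective_id.injOn fun _ _ _ _ h => h

theorem low_of_exists {r : T → T → Prop} {α : Ordinal.{u}} {X : Set T}
    (h : ∀ x ∈ X, ∃ β < α, RankLE r β {y | y ∈ X ∧ r y x}) : RankLE r α X := by
  choose! f hf h using h
  exact .low f hf h

theorem high_of_exists {r : T → T → Prop} {α : Ordinal.{u}} {X : Set T}
    (h : ∀ x ∈ X, ∃ β < α, RankLE r β {y | y ∈ X ∧ r x y}) : RankLE r α X := by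
  choose! f hf h using h
  exact .high f hf h

theorem iUnion {ι : Type*} [Finite ι] {r : T → T → Prop} {α : Ordinal.{u}} {X : ι → Set T}
    (h : ∀ i, RankLE r α (X i)) : RankLE r α (⋃ i, X i) := by
  classical
  have := Fintype.ofFinite ι
  suffices H : ∀ s : Finset ι, RankLE r α (⋃ i ∈ s, X i) from
    (H Finset.univ).mono le_rfl (by simp)
  intro s
  induction s using Finset.induction_on with
  | empty => exact .subsingleton (by simp)
  | insert i s _ ih =>
    rw [Finset.set_biUnion_insert]
    exact (h i).union ih

theorem exists_iUnion {ι : Type*} [Finite ι] {r : T → T → Prop} {δ : Ordinal.{u}}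
    (hδ : 0 < δ) {X : ι → Set T} (h : ∀ i, ∃ β < δ, RankLE r β (X i)) :
    ∃ β < δ, RankLE r β (⋃ i, X i) := by
  choose f hf h using h
  rcases isEmpty_or_nonempty ι with hι | hι
  · exact ⟨0, hδ, .subsingleton (by simp)⟩
  · obtain ⟨i, hi⟩ := Finite.exists_max f
    exact ⟨f i, hf i, .iUnion fun j => (h j).mono (hi j) subset_rfl⟩

end RankLE

/-! ### Comparison with the finite condensation rank -/

section Condensation

variable {A : Type u} [LinearOrder A]

/-- `RankGE α X` says that the rank of the subset `X` of `A` is at least `α`, in the way the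
Morley rank is defined: for every `β < α` there are infinitely many mutually separated subsets of
`X` of rank at least `β`. -/
def RankGE (α : Ordinal.{u}) (X : Set A) : Prop :=
  X.Nonempty ∧ ∀ β, (_ : β < α) → ∃ I : Set (Set A), I.Infinite ∧
    (∀ C ∈ I, ∀ D ∈ I, C ≠ D → SetBelow C D ∨ SetBelow D C) ∧ ∀ C ∈ I, C ⊆ X ∧ RankGE β C
termination_by α

theorem RankGE.nonempty {α : Ordinal.{u}} {X : Set A} (h : RankGE α X) : X.Nonempty := by
  rw [RankGE] at h
  exact h.1

theorem RankGE.exists_infinite {α β : Ordinal.{u}} {X : Set A} (h : RankGE α X) (hβ : β < α) :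
    ∃ I : Set (Set A), I.Infinite ∧
      (∀ C ∈ I, ∀ D ∈ I, C ≠ D → SetBelow C D ∨ SetBelow D C) ∧ ∀ C ∈ I, C ⊆ X ∧ RankGE β C := by
  rw [RankGE] at h
  exact h.2 β hβ

theorem RankGE.exists_setBelow {α β : Ordinal.{u}} {X : Set A} (h : RankGE α X) (hβ : β < α) :
    ∃ C D : Set A, SetBelow C D ∧ C ⊆ X ∧ D ⊆ X ∧ RankGE β C ∧ RankGE β D := by
  obtain ⟨I, hI, hs, hC⟩ := h.exists_infinite hβ
  obtain ⟨C, hCI, D, hDI, hne⟩ := hI.nontrivial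
  rcases hs C hCI D hDI hne with h | h
  · exact ⟨C, D, h, (hC C hCI).1, (hC D hDI).1, (hC C hCI).2, (hC D hDI).2⟩
  · exact ⟨D, C, h, (hC D hDI).1, (hC C hCI).1, (hC D hDI).2, (hC C hCI).2⟩

theorem RankGE.mono {α β : Ordinal.{u}} {X Y : Set A} (h : RankGE α X) (hβ : β ≤ α)
    (hXY : X ⊆ Y) : RankGE β Y := by
  rw [RankGE]
  refine ⟨h.nonempty.mono hXY, fun γ hγ => ?_⟩
  obtain ⟨I, hI, hs, hC⟩ := h.exists_infinite (hγ.trans_le hβ)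
  exact ⟨I, hI, hs, fun C hCI => ⟨(hC C hCI).1.trans hXY, (hC C hCI).2⟩⟩

/-- Infinitely many separated sets whose traces on `X` have rank at least `β` still have separated
traces. -/
theorem exists_infinite_inter {β : Ordinal.{u}} {X : Set A} {I : Set (Set A)}
    (hs : ∀ C ∈ I, ∀ D ∈ I, C ≠ D → SetBelow C D ∨ SetBelow D C)
    (hI : {C ∈ I | RankGE β (C ∩ X)}.Infinite) :
    ∃ J : Set (Set A), J.Infinite ∧
      (∀ C ∈ J, ∀ D ∈ J, C ≠ D → SetBelow C D ∨ SetBelow D C) ∧ ∀ C ∈ J, C ⊆ X ∧ RankGE β C := by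
  refine ⟨(· ∩ X) '' {C ∈ I | RankGE β (C ∩ X)}, hI.image ?_, ?_, ?_⟩
  · rintro C ⟨hC, hC'⟩ D ⟨hD, -⟩ (h : C ∩ X = D ∩ X)
    by_contra hne
    obtain ⟨x, hx⟩ := hC'.nonempty
    have hx' : x ∈ D ∩ X := h ▸ hx
    rcases hs C hC D hD hne with h | h
    · exact lt_irrefl _ (h x hx.1 x hx'.1)
    · exact lt_irrefl _ (h x hx'.1 x hx.1)
  · rintro _ ⟨C, hC, rfl⟩ _ ⟨D, hD, rfl⟩ hne
    refine (hs C hC.1 D hD.1 fun h => hne (by rw [h])).imp ?_ ?_ <;>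
      exact fun h x hx y hy => h x hx.1 y hy.1
  · rintro _ ⟨C, hC, rfl⟩
    exact ⟨Set.inter_subset_right, hC.2⟩

/-- The rank of a union is the maximum of the ranks, by the pigeonhole principle. -/
theorem RankGE.of_union {α : Ordinal.{u}} {X Y : Set A} (h : RankGE α (X ∪ Y)) :
    RankGE α X ∨ RankGE α Y := by
  induction α using WellFoundedLT.induction generalizing X Y with
  | ind α ih =>
  have key : ∀ β < α, (∃ J : Set (Set A), J.Infinite ∧
      (∀ C ∈ J, ∀ D ∈ J, C ≠ D → SetBelow C D ∨ SetBelow D C) ∧ ∀ C ∈ J, C ⊆ X ∧ RankGE β C) ∨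
      ∃ J : Set (Set A), J.Infinite ∧
      (∀ C ∈ J, ∀ D ∈ J, C ≠ D → SetBelow C D ∨ SetBelow D C) ∧ ∀ C ∈ J, C ⊆ Y ∧ RankGE β C := by
    intro β hβ
    obtain ⟨I, hI, hs, hC⟩ := h.exists_infinite hβ
    have : I ⊆ {C ∈ I | RankGE β (C ∩ X)} ∪ {C ∈ I | RankGE β (C ∩ Y)} := by
      intro C hCI
      have hCXY : RankGE β (C ∩ X ∪ C ∩ Y) := by
        rw [← Set.inter_union_distrib_left]
        exact (hC C hCI).2.mono le_rfl (Set.subset_inter subset_rfl (hC C hCI).1)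
      exact (ih β hβ hCXY).imp (⟨hCI, ·⟩) (⟨hCI, ·⟩)
    exact (Set.infinite_union.1 (hI.mono this)).imp
      (exists_infinite_inter hs) (exists_infinite_inter hs)
  -- For `α = 0` nonemptiness is all there is; otherwise it follows from the other condition.
  rcases eq_or_ne α 0 with rfl | hα
  · obtain ⟨x, hx⟩ := h.nonempty
    refine hx.imp ?_ ?_ <;>
    · intro hx
      rw [RankGE]
      exact ⟨⟨x, hx⟩, fun β hβ => absurd hβ not_lt_zero⟩
  have aux : ∀ Z : Set A, (∀ β < α, ∃ J : Set (Set A), J.Infinite ∧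
      (∀ C ∈ J, ∀ D ∈ J, C ≠ D → SetBelow C D ∨ SetBelow D C) ∧ ∀ C ∈ J, C ⊆ Z ∧ RankGE β C) →
      RankGE α Z := by
    intro Z hZ
    rw [RankGE]
    refine ⟨?_, hZ⟩
    obtain ⟨J, hJ, -, hC⟩ := hZ 0 (pos_iff_ne_zero.2 hα)
    obtain ⟨C, hCJ⟩ := hJ.nonempty
    exact (hC C hCJ).2.nonempty.mono (hC C hCJ).1
  by_contra hcon
  rw [not_or] at hcon
  obtain ⟨β, hβ, hX⟩ := not_forall₂.1 (fun h => hcon.1 (aux X h))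
  obtain ⟨γ, hγ, hY⟩ := not_forall₂.1 (fun h => hcon.2 (aux Y h))
  rcases key (max β γ) (max_lt hβ hγ) with ⟨J, hJ, hs, hC⟩ | ⟨J, hJ, hs, hC⟩
  · exact hX ⟨J, hJ, hs, fun C h => ⟨(hC C h).1, (hC C h).2.mono (le_max_left _ _) subset_rfl⟩⟩
  · exact hY ⟨J, hJ, hs, fun C h => ⟨(hC C h).1, (hC C h).2.mono (le_max_right _ _) subset_rfl⟩⟩

theorem RankLE.not_rankGE {α β : Ordinal.{u}} {X : Set A} (h : RankLE (· ≤ ·) β X) (hβ : β < α) :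
    ¬ RankGE α X := by
  induction h generalizing α with
  | subsingleton h =>
    intro hX
    obtain ⟨C, D, hCD, hCX, hDX, hC, hD⟩ := hX.exists_setBelow hβ
    obtain ⟨c, hc⟩ := hC.nonempty
    obtain ⟨d, hd⟩ := hD.nonempty
    exact (hCD c hc d hd).ne (h (hCX hc) (hDX hd))
  | low f hf _ ih =>
    intro hX
    obtain ⟨C, D, hCD, hCX, hDX, hC, hD⟩ := hX.exists_setBelow hβ
    obtain ⟨d, hd⟩ := hD.nonempty
    exact ih d (hDX hd) (hf d (hDX hd))
      (hC.mono le_rfl fun c hc => ⟨hCX hc, (hCD c hc d hd).le⟩)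
  | high f hf _ ih =>
    intro hX
    obtain ⟨C, D, hCD, hCX, hDX, hC, hD⟩ := hX.exists_setBelow hβ
    obtain ⟨c, hc⟩ := hC.nonempty
    exact ih c (hCX hc) (hf c (hCX hc))
      (hD.mono le_rfl fun d hd => ⟨hDX hd, (hCD c hc d hd).le⟩)
  | union _ _ ih₁ ih₂ => exact fun hX => hX.of_union.elim (ih₁ hβ) (ih₂ hβ)

/-- Intervals between `∼_α`-related points have rank at most `α`. -/
theorem rankLE_Icc {α : Ordinal.{u}} {x y : A} (h : fcRel α x y) :
    RankLE (· ≤ ·) α (Set.Icc x y) := by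
  induction α using Ordinal.limitRecOn generalizing x y with
  | zero =>
    rw [fcRel_zero] at h
    exact .subsingleton (by simp [h])
  | add_one α ih =>
    have hc := fcRel_isCondensation (A := A) α
    rw [fcRel_add_one, hc.fcStep_iff] at h
    have := h.to_subtype
    -- Each of the finitely many `∼_α`-classes `Z` meeting the interval is split at a point `c`.
    have key : ∀ Z : relClass (fcRel α) '' Set.uIcc x y, RankLE (· ≤ ·) (α + 1) (Z : Set A) := by
      rintro ⟨_, c, -, rfl⟩
      have hlt : α < α + 1 := Order.lt_add_one_iff.2 le_rfl
      have hup : RankLE (· ≤ ·) (α + 1) {z | fcRel α c z ∧ c ≤ z} :=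
        .low (fun _ => α) (fun _ _ => hlt) fun z hz =>
          (ih hz.1).mono le_rfl fun w hw => ⟨hw.1.2, hw.2⟩
      have hdn : RankLE (· ≤ ·) (α + 1) {z | fcRel α c z ∧ z ≤ c} :=
        .high (fun _ => α) (fun _ _ => hlt) fun z hz =>
          (ih (hc.1.symm hz.1)).mono le_rfl fun w hw => ⟨hw.2, hw.1.2⟩
      exact (hup.union hdn).mono le_rfl fun z hz => (le_total c z).imp (⟨hz, ·⟩) (⟨hz, ·⟩)
    refine (RankLE.iUnion key).mono le_rfl fun z hz => Set.mem_iUnion.2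
      ⟨⟨_, z, Set.Icc_subset_uIcc hz, rfl⟩, hc.1.refl z⟩
  | limit α hα ih =>
    obtain ⟨β, hβ, h⟩ := (fcRel_limit α hα x y).1 h
    exact (ih β hβ h).mono hβ.le subset_rfl

/-- Intervals between points that are not `∼_α`-related have rank at least `α`. -/
theorem rankGE_Icc {α : Ordinal.{u}} {x y : A} (hxy : x ≤ y) (h : ¬ fcRel α x y) :
    RankGE α (Set.Icc x y) := by
  induction α using WellFoundedLT.induction generalizing x y with
  | ind α ih =>
  rw [RankGE]
  refine ⟨Set.nonempty_Icc.2 hxy, fun β hβ => ?_⟩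
  have hc := fcRel_isCondensation (A := A) β
  have h1 : ¬ fcRel (β + 1) x y := fun h' => h (fcRel_mono (Order.add_one_le_of_lt hβ) h')
  rw [fcRel_add_one, hc.fcStep_iff, Set.uIcc_of_le hxy] at h1
  -- A sequence of pairwise inequivalent points of the interval has a monotone subsequence `p`.
  have hinf : (relClass (fcRel β) '' Set.Icc x y).Infinite := h1
  have hmem : ∀ n, ∃ z ∈ Set.Icc x y, relClass (fcRel β) z = hinf.natEmbedding _ n :=
    fun n => (hinf.natEmbedding _ n).2
  choose p hp hpe using hmem
  have hne : ∀ m n, m ≠ n → ¬ fcRel β (p m) (p n) := by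
    intro m n hmn hr
    rw [← hc.relClass_eq, hpe, hpe] at hr
    exact hmn ((hinf.natEmbedding _).injective (Subtype.ext hr))
  obtain ⟨g, hg⟩ := exists_increasing_or_nonincreasing_subseq (· < ·) p
  have hmono : ∀ m n : ℕ, m < n → 2 * m + 1 < 2 * n := fun m n h => by omega
  rcases hg with hg | hg
  · have hlt : ∀ n, p (g (2 * n)) < p (g (2 * n + 1)) := fun n => hg _ _ (by omega)
    have hbel : ∀ m n, m < n → SetBelow (Set.Icc (p (g (2 * m))) (p (g (2 * m + 1))))
        (Set.Icc (p (g (2 * n))) (p (g (2 * n + 1)))) := fun m n hmn a ha b hb =>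
      ha.2.trans_lt ((hg _ _ (hmono m n hmn)).trans_le hb.1)
    refine ⟨Set.range fun n => Set.Icc (p (g (2 * n))) (p (g (2 * n + 1))),
      Set.infinite_range_of_injective ?_, ?_, ?_⟩
    · intro m n (hmn : Set.Icc _ _ = Set.Icc _ _)
      by_contra hcon
      have h1 := Set.left_mem_Icc.2 (hlt m).le
      have h2 := hmn ▸ h1
      rcases lt_or_gt_of_ne hcon with h | h
      · exact lt_irrefl _ (hbel m n h _ h1 _ h2)
      · exact lt_irrefl _ (hbel n m h _ h2 _ h1)
    · rintro _ ⟨m, rfl⟩ _ ⟨n, rfl⟩ hCD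
      rcases lt_trichotomy m n with h | rfl | h
      · exact .inl (hbel m n h)
      · exact absurd rfl hCD
      · exact .inr (hbel n m h)
    · rintro _ ⟨n, rfl⟩
      exact ⟨Set.Icc_subset_Icc (hp _).1 (hp _).2,
        ih β hβ (hlt n).le (hne _ _ fun h => by simpa using g.injective h)⟩
  · have hg' : ∀ m n, m < n → p (g n) < p (g m) := fun m n hmn =>
      lt_of_le_of_ne (not_lt.1 (hg m n hmn)) fun h =>
        hne (g m) (g n) (fun h' => hmn.ne (g.injective h')) (h ▸ hc.1.refl _)
    have hlt : ∀ n, p (g (2 * n + 1)) < p (g (2 * n)) := fun n => hg' _ _ (by omega)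
    have hbel : ∀ m n, m < n → SetBelow (Set.Icc (p (g (2 * n + 1))) (p (g (2 * n))))
        (Set.Icc (p (g (2 * m + 1))) (p (g (2 * m)))) := fun m n hmn a ha b hb =>
      ha.2.trans_lt ((hg' _ _ (hmono m n hmn)).trans_le hb.1)
    refine ⟨Set.range fun n => Set.Icc (p (g (2 * n + 1))) (p (g (2 * n))),
      Set.infinite_range_of_injective ?_, ?_, ?_⟩
    · intro m n (hmn : Set.Icc _ _ = Set.Icc _ _)
      by_contra hcon
      have h1 := Set.left_mem_Icc.2 (hlt m).le
      have h2 := hmn ▸ h1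
      rcases lt_or_gt_of_ne hcon with h | h
      · exact lt_irrefl _ (hbel m n h _ h2 _ h1)
      · exact lt_irrefl _ (hbel n m h _ h1 _ h2)
    · rintro _ ⟨m, rfl⟩ _ ⟨n, rfl⟩ hCD
      rcases lt_trichotomy m n with h | rfl | h
      · exact .inr (hbel m n h)
      · exact absurd rfl hCD
      · exact .inl (hbel n m h)
    · rintro _ ⟨n, rfl⟩
      exact ⟨Set.Icc_subset_Icc (hp _).1 (hp _).2,
        ih β hβ (hlt n).le (hne _ _ fun h => by simpa using g.injective h)⟩

/-- Once one condensation step changes nothing, the relations are stationary. -/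
theorem fcRank_le_of_fcRel_add_one_eq {α : Ordinal.{u}}
    (hα : (fcRel (α + 1) : A → A → Prop) = fcRel α) : fcRank A ≤ α := by
  refine csInf_le' fun β => ?_
  induction β using Ordinal.limitRecOn with
  | zero =>
    intro h
    rw [nonpos_iff_eq_zero.1 h]
  | add_one β ih =>
    intro h
    rcases h.lt_or_eq with hlt | rfl
    · rw [fcRel_add_one, ih (Order.lt_add_one_iff.1 hlt), ← fcRel_add_one, hα]
    · rfl
  | limit β hβ ih =>
    intro h
    funext x y
    refine propext ⟨fun hxy => ?_, fcRel_mono h⟩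
    obtain ⟨γ, hγ, hxy⟩ := (fcRel_limit β hβ x y).1 hxy
    rcases le_total α γ with hle | hle
    · rwa [ih γ hγ hle] at hxy
    · exact fcRel_mono hle hxy

/-- Below the condensation rank, every ordinal `α` is attained: some closed interval has rank at
least `α` and at most `α + 1`. -/
theorem exists_Icc_rank {α : Ordinal.{u}} (hα : α < fcRank A) : ∃ x y : A,
    RankLE (· ≤ ·) (α + 1) (Set.Icc x y) ∧ ∀ β < α, ¬ RankLE (· ≤ ·) β (Set.Icc x y) := by
  have hne : ¬ ∀ x y : A, x ≤ y → fcRel (α + 1) x y → fcRel α x y := by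
    intro hall
    refine hα.not_ge (fcRank_le_of_fcRel_add_one_eq (funext fun x => funext fun y => propext
      ⟨fun h => ?_, fcRel_mono (Order.lt_add_one_iff.2 le_rfl).le⟩))
    rcases le_total x y with hxy | hxy
    · exact hall x y hxy h
    · exact (fcRel_isCondensation α).1.symm
        (hall y x hxy ((fcRel_isCondensation (α + 1)).1.symm h))
  push Not at hne
  obtain ⟨x, y, hxy, h1, h2⟩ := hne
  exact ⟨x, y, rankLE_Icc h1, fun β hβ h => h.not_rankGE hβ (rankGE_Icc hxy h2)⟩

end Condensation

/-! ### Natural sums below powers of `ω` -/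

/-- The natural (Hessenberg) sum of two ordinals below `ω ^ n`: the coefficients of their Cantor
normal forms are added. -/
noncomputable def natAdd : ℕ → Ordinal.{u} → Ordinal.{u} → Ordinal.{u}
  | 0, _, _ => 0
  | n + 1, a, b => ω ^ n * (a / ω ^ n + b / ω ^ n) + natAdd n (a % ω ^ n) (b % ω ^ n)

theorem omega0_pow_pos (n : ℕ) : (0 : Ordinal.{u}) < ω ^ n := pow_pos omega0_pos n

theorem div_omega0_pow_lt {n : ℕ} {a : Ordinal.{u}} (ha : a < ω ^ (n + 1)) : a / ω ^ n < ω := by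
  rwa [← Ordinal.lt_mul_iff_div_lt (omega0_pow_pos n).ne', ← pow_succ]

theorem natAdd_lt {n : ℕ} {a b : Ordinal.{u}} (ha : a < ω ^ n) (hb : b < ω ^ n) :
    natAdd n a b < ω ^ n := by
  induction n generalizing a b with
  | zero => simp [natAdd]
  | succ n ih =>
    have hpos := omega0_pow_pos.{u} n
    have h := ih (mod_lt a hpos.ne') (mod_lt b hpos.ne')
    have hq : a / ω ^ n + b / ω ^ n + 1 < ω :=
      isPrincipal_add_omega0 (isPrincipal_add_omega0 (div_omega0_pow_lt ha) (div_omega0_pow_lt hb))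
        one_lt_omega0
    calc natAdd (n + 1) a b < ω ^ n * (a / ω ^ n + b / ω ^ n) + ω ^ n := by
          rw [natAdd]
          gcongr
      _ = ω ^ n * (a / ω ^ n + b / ω ^ n + 1) := (mul_add_one _ _).symm
      _ ≤ ω ^ n * ω := by gcongr
      _ = ω ^ (n + 1) := (pow_succ _ _).symm

theorem natAdd_comm {n : ℕ} {a b : Ordinal.{u}} (ha : a < ω ^ n) (hb : b < ω ^ n) :
    natAdd n a b = natAdd n b a := by
  induction n generalizing a b with
  | zero => rfl
  | succ n ih =>
    have hpos := omega0_pow_pos.{u} n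
    obtain ⟨k, hk⟩ := lt_omega0.1 (div_omega0_pow_lt ha)
    obtain ⟨l, hl⟩ := lt_omega0.1 (div_omega0_pow_lt hb)
    rw [natAdd, natAdd, ih (mod_lt a hpos.ne') (mod_lt b hpos.ne'), hk, hl, ← Nat.cast_add,
      ← Nat.cast_add, Nat.add_comm]

theorem natAdd_lt_natAdd_left {n : ℕ} {a a' b : Ordinal.{u}} (h : a' < a) (ha : a < ω ^ n)
    (hb : b < ω ^ n) : natAdd n a' b < natAdd n a b := by
  induction n generalizing a a' b with
  | zero => simp at ha; simp [ha] at h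
  | succ n ih =>
    have hpos := omega0_pow_pos.{u} n
    rw [natAdd, natAdd]
    rcases (Ordinal.div_le_left h.le (ω ^ n)).lt_or_eq with hlt | heq
    · obtain ⟨k, hk⟩ := lt_omega0.1 (div_omega0_pow_lt (h.trans ha))
      obtain ⟨l, hl⟩ := lt_omega0.1 (div_omega0_pow_lt ha)
      obtain ⟨m, hm⟩ := lt_omega0.1 (div_omega0_pow_lt hb)
      have hq : a' / ω ^ n + b / ω ^ n + 1 ≤ a / ω ^ n + b / ω ^ n := by
        rw [hk, hl] at hlt
        have := Nat.cast_lt.1 hlt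
        rw [hk, hl, hm]
        exact_mod_cast (by omega : k + m + 1 ≤ l + m)
      calc ω ^ n * (a' / ω ^ n + b / ω ^ n) + natAdd n (a' % ω ^ n) (b % ω ^ n)
          < ω ^ n * (a' / ω ^ n + b / ω ^ n) + ω ^ n := by
            gcongr
            exact natAdd_lt (mod_lt _ hpos.ne') (mod_lt _ hpos.ne')
        _ = ω ^ n * (a' / ω ^ n + b / ω ^ n + 1) := (mul_add_one _ _).symm
        _ ≤ ω ^ n * (a / ω ^ n + b / ω ^ n) := by gcongr
        _ ≤ _ := le_self_add
    · rw [heq]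
      gcongr
      refine ih ?_ (mod_lt _ hpos.ne') (mod_lt _ hpos.ne')
      rw [← Ordinal.div_add_mod a (ω ^ n), ← Ordinal.div_add_mod a' (ω ^ n), heq] at h
      exact lt_of_add_lt_add_left h

theorem natAdd_lt_natAdd_right {n : ℕ} {a b b' : Ordinal.{u}} (h : b' < b) (ha : a < ω ^ n)
    (hb : b < ω ^ n) : natAdd n a b' < natAdd n a b := by
  rw [natAdd_comm ha (h.trans hb), natAdd_comm ha hb]
  exact natAdd_lt_natAdd_left h hb ha

theorem le_natAdd_left {n : ℕ} {a b : Ordinal.{u}} (ha : a < ω ^ n) (hb : b < ω ^ n) :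
    a ≤ natAdd n a b := by
  induction a using WellFoundedLT.induction with
  | ind a ih =>
    exact le_of_forall_lt fun c hc =>
      (ih c hc (hc.trans ha)).trans_lt (natAdd_lt_natAdd_left hc ha hb)

theorem le_natAdd_right {n : ℕ} {a b : Ordinal.{u}} (ha : a < ω ^ n) (hb : b < ω ^ n) :
    b ≤ natAdd n a b := by
  rw [natAdd_comm ha hb]
  exact le_natAdd_left hb ha

/-! ### Preorders on products -/

/-- `R` is a total preorder on `X ×ˢ Y` that extends the product of `r` on `X` and `s` on `Y`, and
`R (x, y) (x', y')` depends only on the colours of the pairs `(x, x')` and `(y, y')`. -/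
structure IsTameProduct {T T' K K' : Type*} (r : T → T → Prop) (s : T' → T' → Prop)
    (R : T × T' → T × T' → Prop) (c : T → T → K) (d : T' → T' → K') (P : K → K' → Prop)
    (X : Set T) (Y : Set T') : Prop where
  trans : ∀ p ∈ X ×ˢ Y, ∀ q ∈ X ×ˢ Y, ∀ w ∈ X ×ˢ Y, R p q → R q w → R p w
  total : ∀ p ∈ X ×ˢ Y, ∀ q ∈ X ×ˢ Y, R p q ∨ R q p
  left : ∀ x ∈ X, ∀ x' ∈ X, ∀ y ∈ Y, R (x, y) (x', y) ↔ r x x'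
  right : ∀ x ∈ X, ∀ y ∈ Y, ∀ y' ∈ Y, R (x, y) (x, y') ↔ s y y'
  colour : ∀ x ∈ X, ∀ x' ∈ X, ∀ y ∈ Y, ∀ y' ∈ Y, R (x, y) (x', y') ↔ P (c x x') (d y y')

namespace IsTameProduct

variable {T T' K K' : Type*} {r : T → T → Prop} {s : T' → T' → Prop}
  {R : T × T' → T × T' → Prop} {c : T → T → K} {d : T' → T' → K'} {P : K → K' → Prop}
  {X : Set T} {Y : Set T'}

theorem mono (h : IsTameProduct r s R c d P X Y) {X' : Set T} {Y' : Set T'} (hX : X' ⊆ X)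
    (hY : Y' ⊆ Y) : IsTameProduct r s R c d P X' Y' where
  trans p hp q hq w hw :=
    h.trans p (Set.prod_mono hX hY hp) q (Set.prod_mono hX hY hq) w (Set.prod_mono hX hY hw)
  total p hp q hq := h.total p (Set.prod_mono hX hY hp) q (Set.prod_mono hX hY hq)
  left x hx x' hx' y hy := h.left x (hX hx) x' (hX hx') y (hY hy)
  right x hx y hy y' hy' := h.right x (hX hx) y (hY hy) y' (hY hy')
  colour x hx x' hx' y hy y' hy' := h.colour x (hX hx) x' (hX hx') y (hY hy) y' (hY hy')

theorem swap (h : IsTameProduct r s R c d P X Y) :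
    IsTameProduct s r (fun p q => R p.swap q.swap) d c (fun k l => P l k) Y X where
  trans p hp q hq w hw := h.trans p.swap ⟨hp.2, hp.1⟩ q.swap ⟨hq.2, hq.1⟩ w.swap ⟨hw.2, hw.1⟩
  total p hp q hq := h.total p.swap ⟨hp.2, hp.1⟩ q.swap ⟨hq.2, hq.1⟩
  left y hy y' hy' x hx := h.right x hx y hy y' hy'
  right y hy x hx x' hx' := h.left x hx x' hx' y hy
  colour y hy y' hy' x hx x' hx' := h.colour x hx x' hx' y hy y' hy'

/-- Finitely many points of a factor have an upper bound among its points. -/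
theorem exists_forall_le (h : IsTameProduct r s R c d P X Y) (hX : X.Nonempty) (hY : Y.Nonempty)
    {ι : Type*} [Finite ι] (f : ι → T) (hf : ∀ i, f i ∈ X) : ∃ m ∈ X, ∀ i, r (f i) m := by
  obtain ⟨y, hy⟩ := hY
  have htr : ∀ a ∈ X, ∀ b ∈ X, ∀ e ∈ X, r a b → r b e → r a e := by
    intro a ha b hb e he
    rw [← h.left a ha b hb y hy, ← h.left b hb e he y hy, ← h.left a ha e he y hy]
    exact h.trans _ ⟨ha, hy⟩ _ ⟨hb, hy⟩ _ ⟨he, hy⟩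
  have : IsTrans X (fun a b => r a b) := ⟨fun a b e => htr a a.2 b b.2 e e.2⟩
  have : Nonempty X := hX.to_subtype
  have hdir : Directed (fun a b : X => r a b) (id : X → X) := by
    intro a b
    have ht : ∀ a ∈ X, ∀ b ∈ X, r a b ∨ r b a := by
      intro a ha b hb
      rw [← h.left a ha b hb y hy, ← h.left b hb a ha y hy]
      exact h.total _ ⟨ha, hy⟩ _ ⟨hb, hy⟩
    have hrefl : ∀ a : X, r a a := fun a => or_self_iff.1 (ht a a.2 a a.2)
    rcases ht a a.2 b b.2 with hab | hab
    · exact ⟨b, hab, hrefl b⟩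
    · exact ⟨a, hrefl a, hab⟩
  obtain ⟨m, hm⟩ := hdir.finite_le (fun i => (⟨f i, hf i⟩ : X))
  exact ⟨m, m.2, hm⟩

theorem low_low (h : IsTameProduct r s R c d P X Y) {γ : Ordinal.{u}}
    (hX : ∀ x ∈ X, ∃ β < γ, RankLE R β ({x' | x' ∈ X ∧ r x' x} ×ˢ Y))
    (hY : ∀ y ∈ Y, ∃ β < γ, RankLE R β (X ×ˢ {y' | y' ∈ Y ∧ s y' y})) : RankLE R γ (X ×ˢ Y) := by
  refine RankLE.low_of_exists fun ⟨x, y⟩ ⟨hx, hy⟩ => ?_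
  obtain ⟨β₁, hβ₁, h₁⟩ := hX x hx
  obtain ⟨β₂, hβ₂, h₂⟩ := hY y hy
  refine ⟨max β₁ β₂, max_lt hβ₁ hβ₂, ((h₁.mono (le_max_left _ _) subset_rfl).union
    (h₂.mono (le_max_right _ _) subset_rfl)).mono le_rfl ?_⟩
  rintro ⟨x', y'⟩ ⟨⟨hx', hy'⟩, hR⟩
  dsimp only at hx hy hx' hy'
  -- If `x'` is not below `x`, then `(x', y') ≤ (x, y) ≤ (x', y)`, so `y'` is below `y`.
  rcases h.total (x', y) ⟨hx', hy⟩ (x, y) ⟨hx, hy⟩ with h' | h'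
  · exact .inl ⟨⟨hx', (h.left x' hx' x hx y hy).1 h'⟩, hy'⟩
  · exact .inr ⟨hx', hy', (h.right x' hx' y' hy' y hy).1
      (h.trans _ ⟨hx', hy'⟩ _ ⟨hx, hy⟩ _ ⟨hx', hy⟩ hR h')⟩

theorem high_high (h : IsTameProduct r s R c d P X Y) {γ : Ordinal.{u}}
    (hX : ∀ x ∈ X, ∃ β < γ, RankLE R β ({x' | x' ∈ X ∧ r x x'} ×ˢ Y))
    (hY : ∀ y ∈ Y, ∃ β < γ, RankLE R β (X ×ˢ {y' | y' ∈ Y ∧ s y y'})) : RankLE R γ (X ×ˢ Y) := by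
  refine RankLE.high_of_exists fun ⟨x, y⟩ ⟨hx, hy⟩ => ?_
  obtain ⟨β₁, hβ₁, h₁⟩ := hX x hx
  obtain ⟨β₂, hβ₂, h₂⟩ := hY y hy
  refine ⟨max β₁ β₂, max_lt hβ₁ hβ₂, ((h₁.mono (le_max_left _ _) subset_rfl).union
    (h₂.mono (le_max_right _ _) subset_rfl)).mono le_rfl ?_⟩
  rintro ⟨x', y'⟩ ⟨⟨hx', hy'⟩, hR⟩
  dsimp only at hx hy hx' hy'
  rcases h.total (x, y) ⟨hx, hy⟩ (x', y) ⟨hx', hy⟩ with h' | h'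
  · exact .inl ⟨⟨hx', (h.left x hx x' hx' y hy).1 h'⟩, hy'⟩
  · exact .inr ⟨hx', hy', (h.right x' hx' y hy y' hy').1
      (h.trans _ ⟨hx', hy⟩ _ ⟨hx, hy⟩ _ ⟨hx', hy'⟩ h' hR)⟩

/-- The case of factors pointing in opposite directions, the only one that needs the colouring (an
arbitrary linear extension of `ω × ω*` need not even be scattered). Call a colour `k` of pairs in
`Y` dominating if for all `x`, `x'` beyond some point, no `(x, y)` lies below an `(x', y')` with
`d y y' = k`. If `Y₁` consists of the `y` such that `d y b` is dominating for some `b` in `Y`,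
then the final segments of `X ×ˢ Y₁` are small because they lie over final segments of `Y`, and
the initial segments of `X ×ˢ (Y \ Y₁)` are small because they lie over initial segments of `X`.
-/
theorem low_high [Finite K'] (h : IsTameProduct r s R c d P X Y) {γ : Ordinal.{u}}
    (hX : ∀ x ∈ X, ∃ β < γ, RankLE R β ({x' | x' ∈ X ∧ r x' x} ×ˢ Y))
    (hY : ∀ y ∈ Y, ∃ β < γ, RankLE R β (X ×ˢ {y' | y' ∈ Y ∧ s y y'})) : RankLE R γ (X ×ˢ Y) := by
  classical
  rcases X.eq_empty_or_nonempty with rfl | hXne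
  · exact .subsingleton (by simp)
  rcases Y.eq_empty_or_nonempty with rfl | hYne
  · exact .subsingleton (by simp)
  let dom : K' → T → Prop := fun k a =>
    ∀ x ∈ X, ∀ x' ∈ X, r a x → r a x' → ¬ P (c x x') k
  have hrt : ∀ a ∈ X, ∀ b ∈ X, r a b ∨ r b a := by
    intro a ha b hb
    obtain ⟨y, hy⟩ := hYne
    rw [← h.left a ha b hb y hy, ← h.left b hb a ha y hy]
    exact h.total _ ⟨ha, hy⟩ _ ⟨hb, hy⟩
  have hrr : ∀ a ∈ X, ∀ b ∈ X, ∀ e ∈ X, r a b → r b e → r a e := by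
    intro a ha b hb e he
    obtain ⟨y, hy⟩ := hYne
    rw [← h.left a ha b hb y hy, ← h.left b hb e he y hy, ← h.left a ha e he y hy]
    exact h.trans _ ⟨ha, hy⟩ _ ⟨hb, hy⟩ _ ⟨he, hy⟩
  -- A point `a` from which on all dominating colours dominate.
  obtain ⟨a, ha, hdom⟩ : ∃ a ∈ X, ∀ k, (∃ a' ∈ X, dom k a') → dom k a := by
    have hex : ∀ k, ∃ a' ∈ X, (∃ a' ∈ X, dom k a') → dom k a' := by
      intro k
      by_cases hk : ∃ a' ∈ X, dom k a'
      · obtain ⟨a', ha', hk'⟩ := hk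
        exact ⟨a', ha', fun _ => hk'⟩
      · exact ⟨hXne.some, hXne.some_mem, fun h => absurd h hk⟩
    choose f hf hfd using hex
    obtain ⟨a, ha, hfa⟩ := h.exists_forall_le hXne hYne f hf
    exact ⟨a, ha, fun k hk x hx x' hx' hax hax' => hfd k hk x hx x' hx'
      (hrr _ (hf k) _ ha _ hx (hfa k) hax) (hrr _ (hf k) _ ha _ hx' (hfa k) hax')⟩
  let X' : Set T := {x | x ∈ X ∧ r a x}
  let Y₁ : Set T' := {y | y ∈ Y ∧ ∃ b ∈ Y, ∃ a' ∈ X, dom (d y b) a'}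
  have hsmall : RankLE R γ ({x | x ∈ X ∧ r x a} ×ˢ Y) := by
    obtain ⟨β, hβ, h'⟩ := hX a ha
    exact h'.mono hβ.le subset_rfl
  have hhigh : RankLE R γ (X' ×ˢ Y₁) := by
    refine RankLE.high_of_exists fun ⟨x, y⟩ hxy => ?_
    obtain ⟨⟨hx, hax⟩, hy, b, hb, hdomb⟩ := hxy
    dsimp only at hx hax hy hdomb
    obtain ⟨β, hβ, h'⟩ := hY b hb
    refine ⟨β, hβ, h'.mono le_rfl ?_⟩
    rintro ⟨x', y'⟩ ⟨⟨⟨hx', hax'⟩, hy', -⟩, hR⟩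
    dsimp only at hx' hax' hy'
    refine ⟨hx', hy', ?_⟩
    rcases h.total (x', b) ⟨hx', hb⟩ (x', y') ⟨hx', hy'⟩ with h1 | h1
    · exact (h.right x' hx' b hb y' hy').1 h1
    · exact absurd ((h.colour x hx x' hx' y hy b hb).1
        (h.trans _ ⟨hx, hy⟩ _ ⟨hx', hy'⟩ _ ⟨hx', hb⟩ hR h1)) (hdom _ hdomb x hx x' hx' hax hax')
  have hlow : RankLE R γ (X' ×ˢ (Y \ Y₁)) := by
    refine RankLE.low_of_exists fun ⟨x, y⟩ hxy => ?_
    obtain ⟨⟨hx, hax⟩, hy, hy1⟩ := hxy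
    dsimp only at hx hax hy hy1
    -- For each colour `k` that is not dominating, a point that bounds what is below `(x, y)`.
    have hex : ∀ k, ∃ x₂ ∈ X, (¬ ∃ a' ∈ X, dom k a') →
        ∃ x₁ ∈ X, r x x₁ ∧ P (c x₁ x₂) k := by
      intro k
      by_cases hk : ∃ a' ∈ X, dom k a'
      · exact ⟨x, hx, fun h => absurd hk h⟩
      · have : ¬ dom k x := fun h => hk ⟨x, hx, h⟩
        simp only [dom] at this
        push Not at this
        obtain ⟨x₁, h1, x₂, h2, h3, -, h4⟩ := this
        exact ⟨x₂, h2, fun _ => ⟨x₁, h1, h3, h4⟩⟩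
    choose f hf hfk using hex
    obtain ⟨m, hm, hfm⟩ := h.exists_forall_le hXne hYne f hf
    obtain ⟨β, hβ, h'⟩ := hX m hm
    refine ⟨β, hβ, h'.mono le_rfl ?_⟩
    rintro ⟨x', y'⟩ ⟨⟨⟨hx', hax'⟩, hy', -⟩, hR⟩
    dsimp only at hx' hax' hy'
    refine ⟨⟨hx', ?_⟩, hy'⟩
    have hnd : ¬ ∃ a' ∈ X, dom (d y y') a' := fun hd => hy1 ⟨hy, y', hy', hd⟩
    obtain ⟨x₁, hx₁, hxx₁, hP⟩ := hfk _ hnd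
    have h1 : R (x₁, y) (f (d y y'), y') := (h.colour _ hx₁ _ (hf _) _ hy _ hy').2 hP
    have h2 : R (x, y) (x₁, y) := (h.left _ hx _ hx₁ _ hy).2 hxx₁
    have h3 : R (x', y') (f (d y y'), y') :=
      h.trans _ ⟨hx', hy'⟩ _ ⟨hx, hy⟩ _ ⟨hf _, hy'⟩ hR
        (h.trans _ ⟨hx, hy⟩ _ ⟨hx₁, hy⟩ _ ⟨hf _, hy'⟩ h2 h1)
    exact hrr _ hx' _ (hf _) _ hm ((h.left _ hx' _ (hf _) _ hy').1 h3) (hfm _)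
  refine ((hsmall.union hhigh).union hlow).mono le_rfl ?_
  rintro ⟨x, y⟩ ⟨hx, hy⟩
  rcases hrt x hx a ha with hxa | hax
  · exact .inl (.inl ⟨⟨hx, hxa⟩, hy⟩)
  · by_cases hy1 : y ∈ Y₁
    · exact .inl (.inr ⟨⟨hx, hax⟩, hy1⟩)
    · exact .inr ⟨⟨hx, hax⟩, hy, hy1⟩

theorem _root_.RankLE.swap {γ : Ordinal.{u}}
    (h : RankLE (fun p q : T' × T => R p.swap q.swap) γ (Y ×ˢ X)) : RankLE R γ (X ×ˢ Y) :=
  h.comap (φ := Prod.swap) le_rfl (fun _ hp => ⟨hp.2, hp.1⟩) Prod.swap_injective.injOn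
    fun _ _ _ _ h => h

theorem high_low [Finite K] (h : IsTameProduct r s R c d P X Y) {γ : Ordinal.{u}}
    (hX : ∀ x ∈ X, ∃ β < γ, RankLE R β ({x' | x' ∈ X ∧ r x x'} ×ˢ Y))
    (hY : ∀ y ∈ Y, ∃ β < γ, RankLE R β (X ×ˢ {y' | y' ∈ Y ∧ s y' y})) : RankLE R γ (X ×ˢ Y) := by
  refine RankLE.swap (h.swap.low_high (fun y hy => ?_) fun x hx => ?_)
  · obtain ⟨β, hβ, h'⟩ := hY y hy
    exact ⟨β, hβ, RankLE.swap h'⟩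
  · obtain ⟨β, hβ, h'⟩ := hX x hx
    exact ⟨β, hβ, RankLE.swap h'⟩

/-- A product has at most the rank of either factor if the other one has at most one point. -/
theorem rankLE_of_subsingleton_left (h : IsTameProduct r s R c d P X Y) (hX : X.Subsingleton)
    {β : Ordinal.{u}} (hY : RankLE s β Y) : RankLE R β (X ×ˢ Y) := by
  refine hY.comap (φ := Prod.snd) le_rfl (fun p hp => hp.2)
    (fun p hp q hq hpq => Prod.ext (hX hp.1 hq.1) hpq) ?_
  rintro ⟨x, y⟩ ⟨hx, hy⟩ ⟨x', y'⟩ ⟨hx', hy'⟩ hR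
  dsimp only at hx hy hx' hy'
  obtain rfl := hX hx hx'
  exact (h.right x hx y hy y' hy').1 hR

/-- The rank of a product is at most the natural sum of the ranks. -/
theorem rankLE_natAdd [Finite K] [Finite K'] {n : ℕ} {α β : Ordinal.{u}} (hX : RankLE r α X)
    (hα : α < ω ^ n) (hY : RankLE s β Y) (hβ : β < ω ^ n) (h : IsTameProduct r s R c d P X Y) :
    RankLE R (natAdd n α β) (X ×ˢ Y) := by
  induction hX generalizing β Y with
  | subsingleton hX =>
    exact (h.rankLE_of_subsingleton_left hX hY).mono (le_natAdd_right hα hβ) subset_rfl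
  | union _ _ ih₁ ih₂ =>
    rw [Set.union_prod]
    exact .union (ih₁ hα hY hβ (h.mono Set.subset_union_left subset_rfl))
      (ih₂ hα hY hβ (h.mono Set.subset_union_right subset_rfl))
  | @low α X f hf hX ihX =>
    have hsX : ∀ {x}, {x' | x' ∈ X ∧ r x' x} ⊆ X := And.left
    have hX' : ∀ {β : Ordinal.{u}} {Y : Set T'}, RankLE s β Y → β < ω ^ n →
        IsTameProduct r s R c d P X Y → ∀ x ∈ X, ∃ β' < natAdd n α β,
          RankLE R β' ({x' | x' ∈ X ∧ r x' x} ×ˢ Y) := fun hY hβ h x hx =>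
      ⟨_, natAdd_lt_natAdd_left (hf x hx) hα hβ,
        ihX x hx ((hf x hx).trans hα) hY hβ (h.mono hsX subset_rfl)⟩
    induction hY with
    | subsingleton hY =>
      exact RankLE.swap ((h.swap.rankLE_of_subsingleton_left hY (.low f hf hX)).mono
        (le_natAdd_left hα hβ) subset_rfl)
    | union _ _ ih₁ ih₂ =>
      rw [Set.prod_union]
      exact .union (ih₁ hβ (h.mono subset_rfl Set.subset_union_left))
        (ih₂ hβ (h.mono subset_rfl Set.subset_union_right))
    | low g hg hY ihY =>
      exact h.low_low (hX' (.low g hg hY) hβ h) fun y hy =>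
        ⟨_, natAdd_lt_natAdd_right (hg y hy) hα hβ,
          ihY y hy ((hg y hy).trans hβ) (h.mono subset_rfl fun _ h => h.1)⟩
    | high g hg hY ihY =>
      exact h.low_high (hX' (.high g hg hY) hβ h) fun y hy =>
        ⟨_, natAdd_lt_natAdd_right (hg y hy) hα hβ,
          ihY y hy ((hg y hy).trans hβ) (h.mono subset_rfl fun _ h => h.1)⟩
  | @high α X f hf hX ihX =>
    have hsX : ∀ {x}, {x' | x' ∈ X ∧ r x x'} ⊆ X := And.left
    have hX' : ∀ {β : Ordinal.{u}} {Y : Set T'}, RankLE s β Y → β < ω ^ n →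
        IsTameProduct r s R c d P X Y → ∀ x ∈ X, ∃ β' < natAdd n α β,
          RankLE R β' ({x' | x' ∈ X ∧ r x x'} ×ˢ Y) := fun hY hβ h x hx =>
      ⟨_, natAdd_lt_natAdd_left (hf x hx) hα hβ,
        ihX x hx ((hf x hx).trans hα) hY hβ (h.mono hsX subset_rfl)⟩
    induction hY with
    | subsingleton hY =>
      exact RankLE.swap ((h.swap.rankLE_of_subsingleton_left hY (.high f hf hX)).mono
        (le_natAdd_left hα hβ) subset_rfl)
    | union _ _ ih₁ ih₂ =>
      rw [Set.prod_union]
      exact .union (ih₁ hβ (h.mono subset_rfl Set.subset_union_left))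
        (ih₂ hβ (h.mono subset_rfl Set.subset_union_right))
    | low g hg hY ihY =>
      exact h.high_low (hX' (.low g hg hY) hβ h) fun y hy =>
        ⟨_, natAdd_lt_natAdd_right (hg y hy) hα hβ,
          ihY y hy ((hg y hy).trans hβ) (h.mono subset_rfl fun _ h => h.1)⟩
    | high g hg hY ihY =>
      exact h.high_high (hX' (.high g hg hY) hβ h) fun y hy =>
        ⟨_, natAdd_lt_natAdd_right (hg y hy) hα hβ,
          ihY y hy ((hg y hy).trans hβ) (h.mono subset_rfl fun _ h => h.1)⟩

end IsTameProduct

/-! ### Decomposing intervals of trees -/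

section Trees

open BinaryTree

variable {S Q : Type} (N : TreeAutomaton (Option S × Option S) Q)

theorem treeConv_injective {S : Type u} {s t s' t' : BinaryTree S}
    (h : treeConv s t = treeConv s' t') : s = s' ∧ t = t' := by
  have key : ∀ w, treeLabel s w = treeLabel s' w ∧ treeLabel t w = treeLabel t' w := by
    intro w
    have hw := congrArg (fun u => treeLabel u w) h
    simp only [treeLabel_treeConv] at hw
    rcases h1 : treeLabel s w <;> rcases h2 : treeLabel t w <;>
      rcases h3 : treeLabel s' w <;> rcases h4 : treeLabel t' w <;> simp_all
  exact ⟨treeLabel_injective (funext fun w => (key w).1),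
    treeLabel_injective (funext fun w => (key w).2)⟩

theorem treeConv_nil {S : Type u} (t : BinaryTree S) :
    treeConv t nil = t.map fun c => (some c, none) := by
  cases t <;> rfl

theorem treeConv_node_right {S : Type u} (s : BinaryTree S) (a : S) (l r : BinaryTree S) :
    treeConv s (node a l r) =
      node (treeLabel s [], some a) (treeConv s.left l) (treeConv s.right r) := by
  cases s <;> rfl

theorem treeConv_node_left {S : Type u} (t : BinaryTree S) (a : S) (l r : BinaryTree S) :
    treeConv (node a l r) t =
      node (some a, treeLabel t []) (treeConv l t.left) (treeConv r t.right) := by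
  cases t
  · rw [BinaryTree.left, BinaryTree.right, treeConv_nil, treeConv_nil, treeConv_nil]
    rfl
  · rfl

/-- The states reached on `x ⊗ z`, `z ⊗ y` and `z ⊗ z`. The first two tell whether `z` lies
between `x` and `y`; the third one makes the orderings of the factors of a product independent of
the context. -/
def profile (x y z : BinaryTree S) : Q × Q × Q :=
  (N.eval (treeConv x z), N.eval (treeConv z y), N.eval (treeConv z z))

theorem profile_node (x y : BinaryTree S) (a : S) (l r : BinaryTree S) :
    profile N x y (node a l r) =
      (N.step (treeLabel x [], some a) (profile N x.left y.left l).1 (profile N x.right y.right r).1,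
       N.step (some a, treeLabel y []) (profile N x.left y.left l).2.1
        (profile N x.right y.right r).2.1,
       N.step (some a, some a) (profile N x.left y.left l).2.2
        (profile N x.right y.right r).2.2) := by
  simp only [profile, treeConv_node_right x, treeConv_node_left y]
  rfl

/-- The trees with a given profile. -/
def profileClass (x y : BinaryTree S) (κ : Q × Q × Q) : Set (BinaryTree S) :=
  {z | profile N x y z = κ}

/-- The relation between trees that the automaton defines with `P` as the set of accepting
states. -/
def treeRel (P : Set Q) (s t : BinaryTree S) : Prop := N.eval (treeConv s t) ∈ P

structure IsTotalPreorderOn {T : Type*} (r : T → T → Prop) (X : Set T) : Prop where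
  trans : ∀ x ∈ X, ∀ y ∈ X, ∀ z ∈ X, r x y → r y z → r x z
  total : ∀ x ∈ X, ∀ y ∈ X, r x y ∨ r y x

theorem IsTotalPreorderOn.comap {T T' : Type*} {r : T → T → Prop} {r' : T' → T' → Prop}
    {Y : Set T} (h : IsTotalPreorderOn r Y) {φ : T' → T} {X : Set T'}
    (hm : Set.MapsTo φ X Y) (hr : ∀ x ∈ X, ∀ y ∈ X, r (φ x) (φ y) ↔ r' x y) :
    IsTotalPreorderOn r' X where
  trans x hx y hy z hz := by
    rw [← hr x hx y hy, ← hr y hy z hz, ← hr x hx z hz]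
    exact h.trans _ (hm hx) _ (hm hy) _ (hm hz)
  total x hx y hy := by
    rw [← hr x hx y hy, ← hr y hy x hx]
    exact h.total _ (hm hx) _ (hm hy)

/-- If no class of the empty pair has its rank between `ω ^ n` and `ω ^ n + 1`, then no totally
preordered class of any pair does. -/
theorem exists_rankLE_profileClass [Finite S] [Finite Q] {n : ℕ}
    (hgap : ∀ κ P, RankLE (treeRel N P) ((ω : Ordinal.{u}) ^ n + 1) (profileClass N nil nil κ) →
      ∃ β < (ω : Ordinal.{u}) ^ n, RankLE (treeRel N P) β (profileClass N nil nil κ))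
    (h : ℕ) (x y : BinaryTree S) (hx : x.height ≤ h) (hy : y.height ≤ h) (κ : Q × Q × Q)
    (P : Set Q) (hP : IsTotalPreorderOn (treeRel N P) (profileClass N x y κ))
    (hκ : RankLE (treeRel N P) ((ω : Ordinal.{u}) ^ n + 1) (profileClass N x y κ)) :
    ∃ β < (ω : Ordinal.{u}) ^ n, RankLE (treeRel N P) β (profileClass N x y κ) := by
  induction h generalizing x y κ P with
  | zero =>
    obtain rfl : x = nil := by cases x <;> simp_all
    obtain rfl : y = nil := by cases y <;> simp_all
    exact hgap κ P hκ
  | succ h ih =>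
    have hpos : (0 : Ordinal.{u}) < ω ^ n := omega0_pow_pos n
    have hch : ∀ z : BinaryTree S, z.height ≤ h + 1 → z.left.height ≤ h ∧ z.right.height ≤ h := by
      rintro (_ | ⟨a, l, r⟩) hz
      · simp
      · simpa using hz
    -- The nonempty trees of the class, sorted by root label and by the profiles of the children.
    let piece : S × (Q × Q × Q) × (Q × Q × Q) → Set (BinaryTree S) := fun i =>
      {z | z ∈ profileClass N x y κ ∧ ∃ l ∈ profileClass N x.left y.left i.2.1,
        ∃ r ∈ profileClass N x.right y.right i.2.2, z = node i.1 l r}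
    have hpiece : ∀ i, ∃ β < (ω : Ordinal.{u}) ^ n, RankLE (treeRel N P) β (piece i) := by
      rintro ⟨a, κl, κr⟩
      rcases (piece (a, κl, κr)).eq_empty_or_nonempty with he | ⟨_, hz, l₀, hl₀, r₀, hr₀, rfl⟩
      · exact ⟨0, hpos, .subsingleton (by rw [he]; exact Set.subsingleton_empty)⟩
      dsimp only at hz hl₀ hr₀
      set X := profileClass N x.left y.left κl with hX
      set Y := profileClass N x.right y.right κr with hY
      have hmem : ∀ l ∈ X, ∀ r ∈ Y, node a l r ∈ profileClass N x y κ := by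
        intro l hl r hr
        have hz' : profile N x y (node a l₀ r₀) = κ := hz
        change profile N x y (node a l r) = κ
        rw [← hz', profile_node, profile_node, show profile N x.left y.left l = κl from hl,
          show profile N x.right y.right r = κr from hr,
          show profile N x.left y.left l₀ = κl from hl₀,
          show profile N x.right y.right r₀ = κr from hr₀]
      have hdl : ∀ l ∈ X, N.eval (treeConv l l) = κl.2.2 := fun l hl =>
        congrArg (fun k => k.2.2) (show profile N x.left y.left l = κl from hl)
      have hdr : ∀ r ∈ Y, N.eval (treeConv r r) = κr.2.2 := fun r hr =>
        congrArg (fun k => k.2.2) (show profile N x.right y.right r = κr from hr)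
      let Pl : Set Q := {q | N.step (some a, some a) q κr.2.2 ∈ P}
      let Pr : Set Q := {q | N.step (some a, some a) κl.2.2 q ∈ P}
      have hl : ∀ l ∈ X, ∀ l' ∈ X, ∀ r ∈ Y,
          treeRel N P (node a l r) (node a l' r) ↔ treeRel N Pl l l' := by
        intro l _ l' _ r hr
        change N.step (some a, some a) (N.eval (treeConv l l')) (N.eval (treeConv r r)) ∈ P ↔ _
        rw [hdr r hr]
        rfl
      have hr : ∀ l ∈ X, ∀ r ∈ Y, ∀ r' ∈ Y,
          treeRel N P (node a l r) (node a l r') ↔ treeRel N Pr r r' := by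
        intro l hl r _ r' _
        change N.step (some a, some a) (N.eval (treeConv l l)) (N.eval (treeConv r r')) ∈ P ↔ _
        rw [hdl l hl]
        rfl
      have hml : Set.MapsTo (fun l => node a l r₀) X (profileClass N x y κ) :=
        fun l hl => hmem l hl r₀ hr₀
      have hmr : Set.MapsTo (fun r => node a l₀ r) Y (profileClass N x y κ) :=
        fun r hr => hmem l₀ hl₀ r hr
      obtain ⟨α, hα, hXα⟩ : ∃ α < (ω : Ordinal.{u}) ^ n, RankLE (treeRel N Pl) α X :=
        ih x.left y.left (hch x hx).1 (hch y hy).1 κl Pl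
          (hP.comap hml fun l h l' h' => hl l h l' h' r₀ hr₀)
          (hκ.comap le_rfl hml (fun l _ l' _ he => by simpa using he)
            fun l h l' h' => (hl l h l' h' r₀ hr₀).2)
      obtain ⟨β, hβ, hYβ⟩ : ∃ β < (ω : Ordinal.{u}) ^ n, RankLE (treeRel N Pr) β Y :=
        ih x.right y.right (hch x hx).2 (hch y hy).2 κr Pr
          (hP.comap hmr fun r h r' h' => hr l₀ hl₀ r h r' h')
          (hκ.comap le_rfl hmr (fun r _ r' _ he => by simpa using he)
            fun r h r' h' => (hr l₀ hl₀ r h r' h').2)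
      have htame : IsTameProduct (treeRel N Pl) (treeRel N Pr)
          (fun p q => treeRel N P (node a p.1 p.2) (node a q.1 q.2))
          (fun s t => N.eval (treeConv s t)) (fun s t => N.eval (treeConv s t))
          (fun k k' => N.step (some a, some a) k k' ∈ P) X Y :=
        { trans := fun p hp q hq w hw => hP.trans _ (hmem _ hp.1 _ hp.2) _ (hmem _ hq.1 _ hq.2) _
            (hmem _ hw.1 _ hw.2)
          total := fun p hp q hq => hP.total _ (hmem _ hp.1 _ hp.2) _ (hmem _ hq.1 _ hq.2)
          left := hl
          right := hr
          colour := fun _ _ _ _ _ _ _ _ => Iff.rfl }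
      refine ⟨natAdd n α β, natAdd_lt hα hβ, (htame.rankLE_natAdd hXα hα hYβ hβ).comap
        (φ := fun z => (z.left, z.right)) le_rfl ?_ ?_ ?_⟩
      · rintro _ ⟨-, l, hl, r, hr, rfl⟩
        exact ⟨hl, hr⟩
      · rintro _ ⟨-, l, -, r, -, rfl⟩ _ ⟨-, l', -, r', -, rfl⟩ he
        simp_all
      · rintro _ ⟨-, l, -, r, -, rfl⟩ _ ⟨-, l', -, r', -, rfl⟩ he
        exact he
    obtain ⟨β, hβ, hU⟩ := RankLE.exists_iUnion hpos hpiece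
    refine ⟨β, hβ, (RankLE.union (.subsingleton (Set.subsingleton_singleton (a := nil)))
      hU).mono le_rfl ?_⟩
    rintro (_ | ⟨a, l, r⟩) hz
    · exact .inl rfl
    · exact .inr (Set.mem_iUnion.2
        ⟨(a, profile N x.left y.left l, profile N x.right y.right r), hz, l, rfl, r, rfl, rfl⟩)

/-- As there are finitely many classes of the empty pair, their ranks avoid almost all of the
intervals between `ω ^ n` and `ω ^ n + 1`. -/
theorem exists_gap [Finite Q] : ∃ n : ℕ, ∀ κ P,
    RankLE (treeRel N P) ((ω : Ordinal.{u}) ^ n + 1) (profileClass N nil nil κ) →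
      ∃ β < (ω : Ordinal.{u}) ^ n, RankLE (treeRel N P) β (profileClass N nil nil κ) := by
  by_contra hcon
  push Not at hcon
  choose κ P h1 h2 using hcon
  obtain ⟨m, n, hne, he⟩ := Finite.exists_ne_map_eq_of_infinite fun n => (κ n, P n)
  wlog hmn : m < n generalizing m n
  · exact this n m hne.symm he.symm (lt_of_le_of_ne (not_lt.1 hmn) hne.symm)
  rw [Prod.mk.injEq] at he
  have hlt : (ω : Ordinal.{u}) ^ m + 1 < ω ^ n := by
    have h1 : (1 : Ordinal.{u}) < ω ^ n := one_lt_pow₀ one_lt_omega0 (by omega)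
    have h2 : (ω : Ordinal.{u}) ^ m < ω ^ n := pow_lt_pow_right₀ one_lt_omega0 hmn
    rw [← opow_natCast ω n] at h1 h2 ⊢
    exact isPrincipal_add_omega0_opow n h2 h1
  exact h2 n _ hlt (he.1 ▸ he.2 ▸ h1 m)

end Trees

theorem theorem4 {A : Type*} [LinearOrder A] (hA : IsTreeAutomatic A) :
    fcRank A < Ordinal.omega0 ^ Ordinal.omega0 := by
  obtain ⟨S, _, Q, _, _, hQ, M, N, μ, hμ, hN⟩ := hA
  by_contra! hcon
  obtain ⟨n, hgap⟩ := exists_gap N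
  have hn : ω ^ n < fcRank A := by
    refine lt_of_lt_of_le ?_ hcon
    rw [← opow_natCast]
    exact (opow_lt_opow_iff_right one_lt_omega0).2 (natCast_lt_omega0 n)
  obtain ⟨x, y, hle, hnot⟩ := exists_Icc_rank hn
  have : Nonempty A := ⟨x⟩
  have hinj : Function.Injective μ := Set.injOn_univ.1 hμ.injOn
  have hleft : ∀ a, Function.invFun μ (μ a) = a := Function.leftInverse_invFun hinj
  have hacc : ∀ s t, treeRel N N.accept s t ↔ ∃ a b, a ≤ b ∧ s = μ a ∧ t = μ b := by
    intro s t
    have : treeConv s t ∈ N.language ↔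
        ∃ a b, a ≤ b ∧ treeConv s t = treeConv (μ a) (μ b) := by
      rw [hN]
      exact Iff.rfl
    refine this.trans ⟨?_, ?_⟩
    · rintro ⟨a, b, hab, he⟩
      exact ⟨a, b, hab, treeConv_injective he⟩
    · rintro ⟨a, b, hab, rfl, rfl⟩
      exact ⟨a, b, hab, rfl⟩
  have hacc' : ∀ a b, treeRel N N.accept (μ a) (μ b) ↔ a ≤ b := by
    intro a b
    rw [hacc]
    exact ⟨fun ⟨a', b', h, ha, hb⟩ => hinj ha ▸ hinj hb ▸ h, fun h => ⟨a, b, h, rfl, rfl⟩⟩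
  -- The profiles of the trees that denote points of the interval.
  let I := {κ : Q × Q × Q // κ.1 ∈ N.accept ∧ κ.2.1 ∈ N.accept}
  have hI : ∀ i : I, ∀ z ∈ profileClass N (μ x) (μ y) i.1, ∃ a ∈ Set.Icc x y, μ a = z := by
    rintro ⟨_, h1, h2⟩ z rfl
    obtain ⟨a, b, hab, ha, rfl⟩ := (hacc _ _).1 h1
    exact ⟨b, ⟨hinj ha ▸ hab, (hacc' _ _).1 h2⟩, rfl⟩
  have hrank : ∀ i : I, ∃ β < ω ^ n,
      RankLE (treeRel N N.accept) β (profileClass N (μ x) (μ y) i.1) := by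
    intro i
    refine exists_rankLE_profileClass N hgap (max (μ x).height (μ y).height) _ _
      (le_max_left _ _) (le_max_right _ _) _ _ ⟨?_, ?_⟩ (hle.comap (φ := Function.invFun μ) le_rfl
      ?_ ?_ ?_)
    · intro s hs t ht u hu
      obtain ⟨a, -, rfl⟩ := hI i s hs
      obtain ⟨b, -, rfl⟩ := hI i t ht
      obtain ⟨c, -, rfl⟩ := hI i u hu
      simp only [hacc']
      exact le_trans
    · intro s hs t ht
      obtain ⟨a, -, rfl⟩ := hI i s hs
      obtain ⟨b, -, rfl⟩ := hI i t ht
      simp only [hacc']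
      exact le_total a b
    · intro s hs
      obtain ⟨a, ha, rfl⟩ := hI i s hs
      rwa [hleft]
    · intro s hs t ht h
      obtain ⟨a, -, rfl⟩ := hI i s hs
      obtain ⟨b, -, rfl⟩ := hI i t ht
      rw [hleft, hleft] at h
      rw [h]
    · intro s hs t ht
      obtain ⟨a, -, rfl⟩ := hI i s hs
      obtain ⟨b, -, rfl⟩ := hI i t ht
      rw [hleft, hleft]
      exact (hacc' a b).1
  obtain ⟨β, hβ, hU⟩ := RankLE.exists_iUnion (omega0_pow_pos n) hrank
  refine hnot β hβ (hU.comap (φ := μ) le_rfl (fun a ha => Set.mem_iUnion.2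
    ⟨⟨profile N (μ x) (μ y) (μ a), ?_, ?_⟩, rfl⟩) hinj.injOn fun a _ b _ => (hacc' a b).2)
  · exact (hacc' x a).2 ha.1
  · exact (hacc' a y).2 ha.2
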